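/- Let $G(s)$ and $H(s)$ be proper real-rational $m\times m$ transfer function matrices, and write $M\ge 0$ ($M>0$) for a Hermitian positive semidefinite (definite) matrix $M$. Assume that $G$ is negative imaginary: (1) $G$ has no pole at the origin and no pole in $\Re s>0$; (2) $j\,(G(j\omega)-G(j\omega)^*)\ge 0$ for every $\omega>0$ such that $j\omega$ is not a pole of $G$; (3) if $j\omega_0$ with $\omega_0>0$ is a pole of $G$, then it is a simple pole and $K_0=\lim_{s\to j\omega_0}(s-j\omega_0)\,sG(s)\ge 0$. Assume that $H$ is strictly negative imaginary: $H$ has no pole in $\Re s\ge 0$, and $j\,(H(j\omega)-H(j\omega)^*)>0$ for all $\omega>0$. Assume further that $G(\infty)H(\infty)=0$, that $H(\infty)\ge 0$, and that the DC gain condition $\lambda_{\max}(G(0)H(0))<1$ holds, where $\lambda_{\max}$ denotes the largest eigenvalue (under these assumptions all eigenvalues of $G(0)H(0)$ are real). Then the positive feedback interconnection of $G$ and $H$ is internally stable. That is, for all minimal state-space realizations $(A_1,B_1,C_1,D_1)$ of $G$ and $(A_2,B_2,C_2,D_2)$ of $H$, the interconnection $\dot x_i=A_ix_i+B_iu_i$,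 $y_i=C_ix_i+D_iu_i$ $(i=1,2)$, $u_1=y_2$, $u_2=y_1$ is well posed ($I-D_1D_2$ is invertible), and the state matrix of the resulting closed-loop system in $(x_1,x_2)$, which under these assumptions equals $$\begin{bmatrix}A_1+B_1D_2C_1 & B_1C_2\\ B_2C_1 & A_2+B_2D_1C_2\end{bmatrix},$$ is Hurwitz, i.e. all its eigenvalues have negative real part. -/

import Mathlib

open Matrix Filter Topology
open scoped ComplexOrder

/-! ### Real-rational transfer function matrices -/

/-- A square real-rational transfer function matrix with `m` inputs and outputs. -/
abbrev TransferMatrix (m : ℕ) : Type := Matrix (Fin m) (Fin m) (RatFunc ℝ)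

namespace TransferMatrix

variable {m : ℕ}

/-- `s` is a pole of some entry of `G`. Numerator and denominator of an element of `RatFunc ℝ`
are coprime, so the poles are exactly the complex roots of the denominators. -/
def IsPole (G : TransferMatrix m) (s : ℂ) : Prop :=
  ∃ i j, (G i j).denom.eval₂ (algebraMap ℝ ℂ) s = 0

/-- The complex matrix `G(s)`; it is meaningful when `s` is not a pole of `G`. -/
noncomputable def evalAt (G : TransferMatrix m) (s : ℂ) : Matrix (Fin m) (Fin m) ℂ :=
  G.map fun f => f.eval (algebraMap ℝ ℂ) s

/-- The real matrix `G(0)`; it is meaningful when `0` is not a pole of `G`. -/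
noncomputable def dcGain (G : TransferMatrix m) : Matrix (Fin m) (Fin m) ℝ :=
  G.map fun f => f.eval (RingHom.id ℝ) 0

/-- The real matrix `G(∞)`, the entrywise limit of `G(s)` as `s → ∞`; the limit exists when `G` is
proper, in particular when `G` has a state-space realization. -/
noncomputable def atInfinity (G : TransferMatrix m) : Matrix (Fin m) (Fin m) ℝ :=
  G.map fun f => limUnder atTop fun x : ℝ => f.eval (RingHom.id ℝ) x

/-- Negative imaginary transfer function matrices (poles on the imaginary axis allowed, except at
the origin). The existence of the limit `K` says that the pole `jω` is simple. -/
structure IsNegativeImaginary (G : TransferMatrix m) : Prop where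
  not_isPole_zero : ¬ G.IsPole 0
  not_isPole_of_re_pos : ∀ s : ℂ, 0 < s.re → ¬ G.IsPole s
  posSemidef : ∀ ω : ℝ, 0 < ω → ¬ G.IsPole (Complex.I * ω) →
    (Complex.I • (G.evalAt (Complex.I * ω) - (G.evalAt (Complex.I * ω))ᴴ)).PosSemidef
  residue : ∀ ω : ℝ, 0 < ω → G.IsPole (Complex.I * ω) →
    ∃ K : Matrix (Fin m) (Fin m) ℂ,
      Tendsto (fun s : ℂ => ((s - Complex.I * ω) * s) • G.evalAt s)
        (𝓝[≠] (Complex.I * ω)) (𝓝 K) ∧ K.PosSemidef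

/-- Strictly negative imaginary transfer function matrices. -/
structure IsStrictlyNegativeImaginary (H : TransferMatrix m) : Prop where
  not_isPole_of_re_nonneg : ∀ s : ℂ, 0 ≤ s.re → ¬ H.IsPole s
  posDef : ∀ ω : ℝ, 0 < ω →
    (Complex.I • (H.evalAt (Complex.I * ω) - (H.evalAt (Complex.I * ω))ᴴ)).PosDef

end TransferMatrix

/-! ### State-space systems -/

/-- A real linear time-invariant system `x' = A x + B u`, `y = C x + D u` with `n` states and `m`
inputs and outputs. -/
structure StateSpace (n m : ℕ) where
  A : Matrix (Fin n) (Fin n) ℝ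
  B : Matrix (Fin n) (Fin m) ℝ
  C : Matrix (Fin m) (Fin n) ℝ
  D : Matrix (Fin m) (Fin m) ℝ

namespace StateSpace

variable {m n n₁ n₂ : ℕ}

/-- The transfer function matrix `C (sI - A)⁻¹ B + D`, over the field of real rational functions
(where `sI - A` is invertible, its determinant being the characteristic polynomial of `A`). -/
noncomputable def transferMatrix (S : StateSpace n m) : TransferMatrix m :=
  S.C.map RatFunc.C * (Matrix.scalar (Fin n) RatFunc.X - S.A.map RatFunc.C)⁻¹ * S.B.map RatFunc.C
    + S.D.map RatFunc.C

/-- `S` is a minimal realization of `G`: it realizes `G`, and no realization of `G` has fewer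
states. -/
def IsMinimalRealization (S : StateSpace n m) (G : TransferMatrix m) : Prop :=
  S.transferMatrix = G ∧ ∀ (k : ℕ) (T : StateSpace k m), T.transferMatrix = G → n ≤ k

/-- The state matrix of the positive feedback interconnection `u₁ = y₂`, `u₂ = y₁`. Solving
`y₁ = C₁ x₁ + D₁ y₂`, `y₂ = C₂ x₂ + D₂ y₁` gives `y₁ = (I - D₁ D₂)⁻¹ (C₁ x₁ + D₁ C₂ x₂)` and
`y₂ = C₂ x₂ + D₂ y₁`, which are substituted in `xᵢ' = Aᵢ xᵢ + Bᵢ uᵢ`. -/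
noncomputable def closedLoop (S₁ : StateSpace n₁ m) (S₂ : StateSpace n₂ m) :
    Matrix (Fin n₁ ⊕ Fin n₂) (Fin n₁ ⊕ Fin n₂) ℝ :=
  let E := (1 - S₁.D * S₂.D)⁻¹
  Matrix.fromBlocks
    (S₁.A + S₁.B * S₂.D * E * S₁.C) (S₁.B * (1 + S₂.D * E * S₁.D) * S₂.C)
    (S₂.B * E * S₁.C) (S₂.A + S₂.B * E * S₁.D * S₂.C)

end StateSpace

/-- A real square matrix is Hurwitz if all its complex eigenvalues have negative real part. -/
def IsHurwitz {ι : Type*} [Fintype ι] [DecidableEq ι] (A : Matrix ι ι ℝ) : Prop :=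
  ∀ z ∈ spectrum ℂ (A.map (algebraMap ℝ ℂ)), z.re < 0

/-- The positive feedback interconnection of `S₁` and `S₂` is internally stable: it is well posed
and its state matrix is Hurwitz. -/
def InternallyStable {m n₁ n₂ : ℕ} (S₁ : StateSpace n₁ m) (S₂ : StateSpace n₂ m) : Prop :=
  IsUnit (1 - S₁.D * S₂.D) ∧ IsHurwitz (S₁.closedLoop S₂)

/-- The largest real eigenvalue of a real square matrix. For a matrix all of whose eigenvalues are
real (such as the product of a symmetric matrix and a positive definite one) this is its maximum
eigenvalue. -/
noncomputable def lambdaMax {m : ℕ} (M : Matrix (Fin m) (Fin m) ℝ) : ℝ :=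
  sSup (spectrum ℝ M)

/-! ### Evaluation of transfer function matrices -/

/-! The proof is a homotopy: replace H by tH with t in [0,1]. As D₁D₂ = 0, every loop is well posed
and its state matrix M(t) is polynomial in t. Away from poles, an eigenvalue s of M(t) yields a
signal u ≠ 0 with u = t G(s)H(s)u (`exists_loop_signal`).

Let T be the set of t for which M(t) has an eigenvalue with positive real part. It is open by
continuity of eigenvalues, and misses t = 0, where u = 0. It is closed unless eigenvalues converge
to the imaginary axis. A limit at 0 would make 1/t ≥ 1 an eigenvalue of G(0)H(0). At a limit jω with
ω > 0, put v = Hu: then Im v*u = -Im u*Hu > 0, whereas Im v*u = t Im v*Gv ≤ 0. By connectedness T is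
empty.

At t = 1 the imaginary axis itself remains; the same two arguments exclude it. The delicate case is
a pole jω of G. There G(s) = K/(jω(s - jω)) + R + o(1) with K ≥ 0 and Im v*Rv ≤ 0
(`exists_laurent`). In the right half plane the polar part only helps the sign. On the axis,
controllability puts the residues of the state response in the range of K, where they are orthogonal
to the loop signal, and observability turns a vanishing signal into a vanishing state. -/

/-- `RatFunc.eval` uses the reduced fraction. Any other fraction gives the same value where its
denominator is nonzero, because the reduced denominator divides it. -/
theorem RatFunc.eval_of_mul_algebraMap_eq {L : Type} [Field L] (φ : ℝ →+* L) (a : L)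
    {f : RatFunc ℝ} {p q : Polynomial ℝ}
    (h : f * algebraMap _ (RatFunc ℝ) q = algebraMap _ (RatFunc ℝ) p)
    (hq : q.eval₂ φ a ≠ 0) :
    f.eval φ a = (q.eval₂ φ a)⁻¹ * p.eval₂ φ a := by
  have hq0 : q ≠ 0 := by rintro rfl; simp at hq
  have hq0' : algebraMap _ (RatFunc ℝ) q ≠ 0 := by
    simpa using hq0
  have hf : f = algebraMap _ (RatFunc ℝ) p / algebraMap _ (RatFunc ℝ) q :=
    (eq_div_iff hq0').2 h
  have hd : f.denom.eval₂ φ a ≠ 0 := by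
    obtain ⟨r, hr⟩ := (RatFunc.denom_dvd hq0).2 ⟨p, hf⟩
    intro h0
    apply hq
    rw [hr, Polynomial.eval₂_mul, h0, zero_mul]
  have hd' : algebraMap _ (RatFunc ℝ) f.denom ≠ 0 := by simpa using f.denom_ne_zero
  have h1 : f.num * q = p * f.denom := by
    apply RatFunc.algebraMap_injective ℝ
    rw [map_mul, map_mul, ← h]
    nth_rewrite 2 [← RatFunc.num_div_denom f]
    field_simp
  have h2 : f.num.eval₂ φ a * q.eval₂ φ a = p.eval₂ φ a * f.denom.eval₂ φ a := by
    rw [← Polynomial.eval₂_mul, h1, Polynomial.eval₂_mul]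
  rw [RatFunc.eval]
  field_simp
  linear_combination h2

namespace StateSpace

variable {n m : ℕ}

/-- The numerator of the transfer function matrix over the characteristic polynomial. -/
noncomputable def numerator (S : StateSpace n m) : Matrix (Fin m) (Fin m) (Polynomial ℝ) :=
  S.C.map Polynomial.C * S.A.charmatrix.adjugate * S.B.map Polynomial.C
    + S.A.charpoly • S.D.map Polynomial.C

/-- Cramer's rule: the characteristic polynomial clears all denominators of the resolvent. -/
theorem transferMatrix_mul_charpoly (S : StateSpace n m) (i j : Fin m) :
    S.transferMatrix i j * algebraMap _ (RatFunc ℝ) S.A.charpoly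
      = algebraMap _ (RatFunc ℝ) (S.numerator i j) := by
  set am := algebraMap (Polynomial ℝ) (RatFunc ℝ)
  have hC : (am ∘ Polynomial.C : ℝ → RatFunc ℝ) = RatFunc.C := by
    funext x; simp [am]
  have hX : S.A.charmatrix.map am = Matrix.scalar (Fin n) RatFunc.X - S.A.map RatFunc.C := by
    ext i j
    simp [Matrix.charmatrix, Matrix.diagonal_apply, am]
    split_ifs <;> simp
  have hdet : (S.A.charmatrix.map am).det = am S.A.charpoly := by
    rw [Matrix.charpoly, RingHom.map_det]; rfl
  have hne : am S.A.charpoly ≠ 0 := by simpa [am] using S.A.charpoly_monic.ne_zero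
  have hinv : am S.A.charpoly • (S.A.charmatrix.map am)⁻¹ = S.A.charmatrix.adjugate.map am := by
    rw [Matrix.inv_def, hdet, smul_smul, Ring.inverse_eq_inv, mul_inv_cancel₀ hne, one_smul]
    exact (RingHom.map_adjugate am _).symm
  have hN : S.numerator.map am = am S.A.charpoly • S.transferMatrix := by
    rw [numerator, transferMatrix, smul_add, ← hX]
    have e : ∀ (X Y : Matrix (Fin m) (Fin m) (Polynomial ℝ)), (X + Y).map am = X.map am + Y.map am :=
      fun X Y => by ext; simp
    rw [e, Matrix.map_mul, Matrix.map_mul, Matrix.map_map, Matrix.map_map, hC, ← hinv]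
    simp only [Matrix.mul_smul, Matrix.smul_mul]
    congr 1
    ext i j
    simp [am]
  have := congrFun (congrFun hN i) j
  simp only [Matrix.map_apply, Matrix.smul_apply, smul_eq_mul] at this
  rw [this, mul_comm]

theorem charpoly_eval₂ {L : Type} [Field L] (φ : ℝ →+* L) (a : L)
    (A : Matrix (Fin n) (Fin n) ℝ) :
    A.charpoly.eval₂ φ a = (Matrix.scalar (Fin n) a - A.map φ).det := by
  rw [← Matrix.eval_charpoly, ← Polynomial.eval_map, ← Matrix.charpoly_map]

theorem transferMatrix_eval {L : Type} [Field L] (φ : ℝ →+* L) (a : L) (S : StateSpace n m)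
    (h : (Matrix.scalar (Fin n) a - S.A.map φ).det ≠ 0) :
    S.transferMatrix.map (fun f => f.eval φ a)
      = S.C.map φ * (Matrix.scalar (Fin n) a - S.A.map φ)⁻¹ * S.B.map φ + S.D.map φ := by
  have hN : S.numerator.map (Polynomial.eval₂RingHom φ a)
      = (Matrix.scalar (Fin n) a - S.A.map φ).det •
        (S.C.map φ * (Matrix.scalar (Fin n) a - S.A.map φ)⁻¹ * S.B.map φ + S.D.map φ) := by
    have hX : S.A.charmatrix.map (Polynomial.eval₂RingHom φ a)
        = Matrix.scalar (Fin n) a - S.A.map φ := by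
      ext i j
      simp [Matrix.charmatrix, Matrix.diagonal_apply]
      split_ifs <;> simp
    have hC : (Polynomial.eval₂RingHom φ a ∘ Polynomial.C : ℝ → L) = φ := by
      funext x; simp
    have e : ∀ (X Y : Matrix (Fin m) (Fin m) (Polynomial ℝ)),
        (X + Y).map (Polynomial.eval₂RingHom φ a)
          = X.map (Polynomial.eval₂RingHom φ a) + Y.map (Polynomial.eval₂RingHom φ a) :=
      fun X Y => by ext; simp
    have hadj : S.A.charmatrix.adjugate.map (Polynomial.eval₂RingHom φ a)
        = (Matrix.scalar (Fin n) a - S.A.map φ).det •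
          (Matrix.scalar (Fin n) a - S.A.map φ)⁻¹ := by
      rw [Matrix.inv_def, smul_smul, Ring.inverse_eq_inv, mul_inv_cancel₀ h, one_smul, ← hX]
      exact RingHom.map_adjugate _ _
    rw [numerator, e, Matrix.map_mul, Matrix.map_mul, Matrix.map_map, Matrix.map_map, hC, hadj,
      smul_add]
    simp only [Matrix.mul_smul, Matrix.smul_mul]
    congr 1
    ext i j
    simp [charpoly_eval₂]
  ext i j
  have h1 := RatFunc.eval_of_mul_algebraMap_eq φ a (S.transferMatrix_mul_charpoly i j)
    (by rwa [charpoly_eval₂])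
  have h2 := congrFun (congrFun hN i) j
  rw [Matrix.map_apply, Matrix.smul_apply, smul_eq_mul, Polynomial.coe_eval₂RingHom] at h2
  rw [Matrix.map_apply, h1, h2, charpoly_eval₂, inv_mul_cancel_left₀ h]

theorem evalAt_transferMatrix (S : StateSpace n m) (s : ℂ)
    (h : (Matrix.scalar (Fin n) s - S.A.map (algebraMap ℝ ℂ)).det ≠ 0) :
    S.transferMatrix.evalAt s = S.C.map (algebraMap ℝ ℂ) *
      (Matrix.scalar (Fin n) s - S.A.map (algebraMap ℝ ℂ))⁻¹ * S.B.map (algebraMap ℝ ℂ)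
      + S.D.map (algebraMap ℝ ℂ) :=
  S.transferMatrix_eval _ _ h

theorem atInfinity_transferMatrix (S : StateSpace n m) :
    S.transferMatrix.atInfinity = S.D := by
  have hev : ∀ᶠ x : ℝ in atTop, (Matrix.scalar (Fin n) x - S.A.map (RingHom.id ℝ)).det ≠ 0 := by
    have hfin : {x : ℝ | S.A.charpoly.IsRoot x}.Finite :=
      Polynomial.finite_setOfPred_isRoot S.A.charpoly_monic.ne_zero
    filter_upwards [(atTop_le_cofinite : (atTop : Filter ℝ) ≤ _) hfin.compl_mem_cofinite] with x hx
    rw [← charpoly_eval₂]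
    simpa [Polynomial.IsRoot] using hx
  have hlim : Tendsto (fun x : ℝ => S.C * (Matrix.scalar (Fin n) x - S.A)⁻¹ * S.B + S.D)
      atTop (𝓝 S.D) := by
    have h0 : Tendsto (fun x : ℝ => x⁻¹) atTop (𝓝 0) := tendsto_inv_atTop_zero
    -- With t = 1/x, (x - A)⁻¹ = t(1 - tA)⁻¹, which is continuous at t = 0 and vanishes there.
    have hc : ContinuousAt (fun t : ℝ =>
        S.C * (t • ((1 - t • S.A).det⁻¹ • (1 - t • S.A).adjugate)) * S.B + S.D) 0 := by
      have hd : ContinuousAt (fun t : ℝ => (1 - t • S.A).det⁻¹) 0 := by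
        apply ContinuousAt.inv₀
        · exact Continuous.continuousAt (by fun_prop)
        · simp
      have ha : ContinuousAt (fun t : ℝ => (1 - t • S.A).adjugate) 0 :=
        Continuous.continuousAt (Continuous.matrix_adjugate (by fun_prop))
      have h1 := continuousAt_id.smul (hd.smul ha)
      have hg : Continuous (fun X : Matrix (Fin n) (Fin n) ℝ => S.C * X * S.B + S.D) := by fun_prop
      exact hg.continuousAt.comp h1
    have h1 := hc.tendsto.comp h0
    simp only [zero_smul, Matrix.mul_zero, Matrix.zero_mul, zero_add] at h1
    refine h1.congr' ?_
    filter_upwards [hev, eventually_gt_atTop 0] with x hx hx0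
    simp only [Function.comp]
    have hs : Matrix.scalar (Fin n) x - S.A = x • (1 - x⁻¹ • S.A) := by
      rw [smul_sub, smul_smul, mul_inv_cancel₀ hx0.ne', one_smul, Matrix.smul_one_eq_diagonal]
      rfl
    congr 3
    rw [hs]
    have : Invertible x := invertibleOfNonzero hx0.ne'
    have hx' : IsUnit (1 - x⁻¹ • S.A).det := by
      have : (Matrix.scalar (Fin n) x - S.A).det ≠ 0 := by simpa using hx
      rw [hs, Matrix.det_smul] at this
      exact (right_ne_zero_of_mul this).isUnit
    rw [Matrix.inv_smul _ _ hx', invOf_eq_inv, Matrix.inv_def, Ring.inverse_eq_inv]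
  ext i j
  rw [TransferMatrix.atInfinity, Matrix.map_apply]
  refine Tendsto.limUnder_eq ?_
  have h1 := ((continuous_apply_apply i j).tendsto S.D).comp hlim
  refine h1.congr' ?_
  filter_upwards [hev] with x hx
  have := congrFun (congrFun (S.transferMatrix_eval (RingHom.id ℝ) x hx) i) j
  simpa [Function.comp] using this.symm

end StateSpace

theorem TransferMatrix.map_dcGain {m : ℕ} (G : TransferMatrix m) :
    G.dcGain.map (algebraMap ℝ ℂ) = G.evalAt 0 := by
  ext i j
  have h : ∀ p : Polynomial ℝ, (algebraMap ℝ ℂ) (p.eval₂ (RingHom.id ℝ) 0)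
      = p.eval₂ (algebraMap ℝ ℂ) 0 := fun p => by
    rw [Polynomial.hom_eval₂, map_zero, RingHom.comp_id]
  simp only [TransferMatrix.dcGain, TransferMatrix.evalAt, Matrix.map_apply, RatFunc.eval, map_div₀, h]

/-! ### Minimal realizations -/

namespace StateSpace

variable {n m : ℕ}

theorem det_scalar_X_sub_ne_zero {n : ℕ} (A : Matrix (Fin n) (Fin n) ℝ) :
    (Matrix.scalar (Fin n) RatFunc.X - A.map RatFunc.C).det ≠ 0 := by
  have h : (Matrix.scalar (Fin n) RatFunc.X - A.map RatFunc.C).det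
      = algebraMap (Polynomial ℝ) (RatFunc ℝ) A.charpoly := by
    rw [Matrix.charpoly, RingHom.map_det]
    congr 1
    ext i j
    simp [Matrix.charmatrix, Matrix.diagonal_apply]
    split_ifs <;> simp
  rw [h]
  simpa using A.charpoly_monic.ne_zero

/-- Restricting the state space along an injection that intertwines the dynamics does not change
the transfer function matrix. -/
theorem transferMatrix_eq_of_intertwine {k n m : ℕ} {S : StateSpace n m} {T : StateSpace k m}
    (J : Matrix (Fin n) (Fin k) ℝ) (hA : S.A * J = J * T.A) (hB : S.B = J * T.B)
    (hC : T.C = S.C * J) (hD : T.D = S.D) : T.transferMatrix = S.transferMatrix := by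
  have hS := (det_scalar_X_sub_ne_zero S.A).isUnit
  have hT := (det_scalar_X_sub_ne_zero T.A).isUnit
  set P := Matrix.scalar (Fin n) (RatFunc.X : RatFunc ℝ) - S.A.map RatFunc.C with hP
  set Q := Matrix.scalar (Fin k) (RatFunc.X : RatFunc ℝ) - T.A.map RatFunc.C with hQ
  set J' := J.map (RatFunc.C : ℝ →+* RatFunc ℝ) with hJ'
  have hPJ : P * J' = J' * Q := by
    have h1 : S.A.map RatFunc.C * J' = J' * T.A.map (RatFunc.C : ℝ →+* RatFunc ℝ) := by
      rw [← Matrix.map_mul, hA, Matrix.map_mul]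
    rw [hP, hQ, Matrix.sub_mul, Matrix.mul_sub, h1]
    congr 1
    ext i j
    simp [mul_comm]
  have hJ : P⁻¹ * J' = J' * Q⁻¹ := by
    calc P⁻¹ * J' = P⁻¹ * (J' * Q) * Q⁻¹ := by
          rw [Matrix.mul_assoc, Matrix.mul_assoc, Matrix.mul_nonsing_inv _ hT, Matrix.mul_one]
      _ = J' * Q⁻¹ := by
          rw [← hPJ, ← Matrix.mul_assoc, Matrix.nonsing_inv_mul _ hS, Matrix.one_mul]
  rw [transferMatrix, transferMatrix, ← hP, ← hQ, hB, hC, hD, Matrix.map_mul, Matrix.map_mul,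
    ← hJ', Matrix.mul_assoc (S.C.map _) _ Q⁻¹, ← hJ]
  simp only [Matrix.mul_assoc]

/-- The dual system. -/
def dual (S : StateSpace n m) : StateSpace n m := ⟨S.Aᵀ, S.Cᵀ, S.Bᵀ, S.Dᵀ⟩

theorem transferMatrix_dual (S : StateSpace n m) :
    S.dual.transferMatrix = S.transferMatrixᵀ := by
  have h : (Matrix.scalar (Fin n) RatFunc.X - S.Aᵀ.map RatFunc.C)
      = (Matrix.scalar (Fin n) (RatFunc.X : RatFunc ℝ) - S.A.map RatFunc.C)ᵀ := by
    rw [Matrix.transpose_sub, Matrix.transpose_map]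
    simp
  rw [transferMatrix, transferMatrix, dual, h]
  simp only [Matrix.transpose_add, Matrix.transpose_mul, Matrix.transpose_map,
    Matrix.transpose_nonsing_inv, Matrix.mul_assoc]

theorem IsMinimalRealization.dual {S : StateSpace n m} {G : TransferMatrix m}
    (h : S.IsMinimalRealization G) : S.dual.IsMinimalRealization Gᵀ := by
  refine ⟨by rw [transferMatrix_dual, h.1], fun k T hT => h.2 k T.dual ?_⟩
  rw [transferMatrix_dual, hT, Matrix.transpose_transpose]

/-- Controllability of a minimal realization. -/
theorem IsMinimalRealization.eq_top {S : StateSpace n m} {G : TransferMatrix m}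
    (h : S.IsMinimalRealization G) (V : Submodule ℝ (Fin n → ℝ))
    (hA : ∀ x ∈ V, S.A *ᵥ x ∈ V) (hB : ∀ v, S.B *ᵥ v ∈ V) : V = ⊤ := by
  -- In a basis of V, the columns of J, the system restricted to V is a realization of G with dim V
  -- states; minimality then forces n ≤ dim V.
  let b := Module.finBasis ℝ V
  set k := Module.finrank ℝ V with hk
  let J : Matrix (Fin n) (Fin k) ℝ := Matrix.of fun i j => (b j : Fin n → ℝ) i
  have hJ : ∀ x : V, J *ᵥ (b.repr x) = x := by
    intro x
    ext i
    have := congrArg (fun z : V => (z : Fin n → ℝ) i) (b.sum_repr x)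
    simp only [Submodule.coe_sum, Submodule.coe_smul, Finset.sum_apply, Pi.smul_apply,
      smul_eq_mul] at this
    simpa only [J, Matrix.mulVec, dotProduct, mul_comm, Matrix.of_apply] using this
  let A' : Matrix (Fin k) (Fin k) ℝ :=
    Matrix.of fun i j => b.repr ⟨S.A *ᵥ (b j : Fin n → ℝ), hA _ (b j).2⟩ i
  let B' : Matrix (Fin k) (Fin m) ℝ :=
    Matrix.of fun i j => b.repr ⟨S.B *ᵥ (Pi.single j 1), hB _⟩ i
  have hle := h.2 k ⟨A', B', S.C * J, S.D⟩ (by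
    rw [← h.1]
    refine transferMatrix_eq_of_intertwine J ?_ ?_ rfl rfl
    · ext i j
      have := congrFun (hJ ⟨S.A *ᵥ (b j : Fin n → ℝ), hA _ (b j).2⟩) i
      exact this.symm
    · ext i j
      have := congrFun (hJ ⟨S.B *ᵥ (Pi.single j 1), hB _⟩) i
      simp only [Matrix.mulVec_single_one] at this
      refine Eq.trans this.symm ?_
      simp [Matrix.mul_apply, B', Matrix.mulVec, dotProduct])
  apply Submodule.eq_top_of_finrank_eq
  apply le_antisymm (Submodule.finrank_le V)
  simpa [← hk] using hle

/-- Controllability of a minimal realization, over the complex numbers. -/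
theorem IsMinimalRealization.eq_top_complex {S : StateSpace n m} {G : TransferMatrix m}
    (h : S.IsMinimalRealization G) (W : Submodule ℂ (Fin n → ℂ))
    (hA : ∀ x ∈ W, S.A.map (algebraMap ℝ ℂ) *ᵥ x ∈ W)
    (hB : ∀ v, S.B.map (algebraMap ℝ ℂ) *ᵥ v ∈ W) : W = ⊤ := by
  have key : ∀ {p q : ℕ} (M : Matrix (Fin p) (Fin q) ℝ) (x : Fin q → ℝ),
      (fun i => ((M *ᵥ x) i : ℂ)) = M.map (algebraMap ℝ ℂ) *ᵥ (fun i => (x i : ℂ)) := by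
    intro p q M x
    ext i
    simp [Matrix.mulVec, dotProduct]
  -- The real vectors of W form a real invariant subspace containing the range of B, so the real
  -- case applies; real and imaginary parts then fill the complex space.
  let V : Submodule ℝ (Fin n → ℝ) :=
    { carrier := {x | (fun i => (x i : ℂ)) ∈ W}
      add_mem' := fun {x y} hx hy => by
        have := W.add_mem hx hy
        simpa [Pi.add_def] using this
      zero_mem' := by
        have := W.zero_mem
        simpa [Pi.zero_def] using this
      smul_mem' := fun c x hx => by
        have := W.smul_mem (c : ℂ) hx
        simpa [Pi.smul_def] using this }
  have hV : V = ⊤ := by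
    refine h.eq_top V (fun x hx => ?_) (fun v => ?_)
    · change (fun i => ((S.A *ᵥ x) i : ℂ)) ∈ W
      rw [key]
      exact hA _ hx
    · change (fun i => ((S.B *ᵥ v) i : ℂ)) ∈ W
      rw [key]
      exact hB _
  have hreal : ∀ x : Fin n → ℝ, (fun i => (x i : ℂ)) ∈ W := fun x => by
    have : x ∈ V := by rw [hV]; trivial
    exact this
  rw [eq_top_iff]
  intro z _
  have hz : z = (fun i => ((z i).re : ℂ)) + Complex.I • (fun i => ((z i).im : ℂ)) := by
    ext i
    simp [mul_comm Complex.I, Complex.re_add_im]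
  rw [hz]
  exact W.add_mem (hreal _) (W.smul_mem _ (hreal _))

/-- Observability of a minimal realization. -/
theorem IsMinimalRealization.eq_zero_of_eigenvector {S : StateSpace n m} {G : TransferMatrix m}
    (h : S.IsMinimalRealization G) {s : ℂ} {x : Fin n → ℂ}
    (hA : S.A.map (algebraMap ℝ ℂ) *ᵥ x = s • x) (hC : S.C.map (algebraMap ℝ ℂ) *ᵥ x = 0) :
    x = 0 := by
  -- The annihilator of x for the bilinear pairing is Aᵀ-invariant and contains the range of Cᵀ.
  -- Controllability of the dual makes it everything, so it contains the conjugate of x.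
  let W : Submodule ℂ (Fin n → ℂ) :=
    { carrier := {w | w ⬝ᵥ x = 0}
      add_mem' := fun {a b} ha hb => by
        simp only [Set.mem_ofPred_eq] at ha hb ⊢
        rw [add_dotProduct, ha, hb, add_zero]
      zero_mem' := by simp
      smul_mem' := fun c w hw => by
        simp only [Set.mem_ofPred_eq] at hw ⊢
        rw [smul_dotProduct, hw, smul_zero] }
  have hW : W = ⊤ := by
    refine h.dual.eq_top_complex W (fun w hw => ?_) (fun v => ?_)
    · change (S.Aᵀ.map (algebraMap ℝ ℂ) *ᵥ w) ⬝ᵥ x = 0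
      rw [Matrix.transpose_map, Matrix.mulVec_transpose, ← Matrix.dotProduct_mulVec, hA,
        dotProduct_smul, show w ⬝ᵥ x = 0 from hw, smul_zero]
    · change (S.Cᵀ.map (algebraMap ℝ ℂ) *ᵥ v) ⬝ᵥ x = 0
      rw [Matrix.transpose_map, Matrix.mulVec_transpose, ← Matrix.dotProduct_mulVec, hC,
        dotProduct_zero]
  have hx : star x ∈ W := by rw [hW]; trivial
  exact dotProduct_star_self_eq_zero.1 hx

/-- The output response `C (s - A)⁻¹ x` to the initial state `x`. -/
noncomputable def output (S : StateSpace n m) (s : ℂ) (x : Fin n → ℂ) : Fin m → ℂ :=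
  S.C.map (algebraMap ℝ ℂ) *ᵥ
    ((Matrix.scalar (Fin n) s - S.A.map (algebraMap ℝ ℂ))⁻¹ *ᵥ x)

theorem eventually_det_ne_zero (S : StateSpace n m) (s₀ : ℂ) :
    ∀ᶠ s in 𝓝[≠] s₀, (Matrix.scalar (Fin n) s - S.A.map (algebraMap ℝ ℂ)).det ≠ 0 := by
  have hne : (S.A.map (algebraMap ℝ ℂ)).charpoly ≠ 0 := (Matrix.charpoly_monic _).ne_zero
  have hfin : {x : ℂ | (S.A.map (algebraMap ℝ ℂ)).charpoly.IsRoot x}.Finite :=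
    Polynomial.finite_setOfPred_isRoot hne
  have := (hfin.subset (Set.sdiff_subset (t := {s₀}))).isClosed.isOpen_compl.mem_nhds
    (show s₀ ∈ _ by simp)
  filter_upwards [mem_nhdsWithin_of_mem_nhds this, self_mem_nhdsWithin] with s hs hs'
  rw [← Matrix.eval_charpoly]
  intro h0
  exact hs ⟨h0, hs'⟩

/-- The resolvent identity behind all residue computations below: it trades A for multiplication by
s, up to the term Cx, which does not depend on s. -/
theorem resolvent_mulVec_sub (S : StateSpace n m) {s : ℂ}
    (h : (Matrix.scalar (Fin n) s - S.A.map (algebraMap ℝ ℂ)).det ≠ 0) (x : Fin n → ℂ) :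
    S.output s (s • x - S.A.map (algebraMap ℝ ℂ) *ᵥ x) = S.C.map (algebraMap ℝ ℂ) *ᵥ x := by
  have : s • x - S.A.map (algebraMap ℝ ℂ) *ᵥ x
      = (Matrix.scalar (Fin n) s - S.A.map (algebraMap ℝ ℂ)) *ᵥ x := by
    rw [Matrix.sub_mulVec]
    congr 1
    ext i
    simp [Matrix.mulVec_diagonal]
  rw [output, this, Matrix.mulVec_mulVec _ _⁻¹, Matrix.nonsing_inv_mul _ h.isUnit, Matrix.one_mulVec]

theorem output_add (S : StateSpace n m) (s : ℂ) (x y : Fin n → ℂ) :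
    S.output s (x + y) = S.output s x + S.output s y := by
  simp only [output, Matrix.mulVec_add]

theorem output_sub (S : StateSpace n m) (s : ℂ) (x y : Fin n → ℂ) :
    S.output s (x - y) = S.output s x - S.output s y := by
  simp only [output, Matrix.mulVec_sub]

theorem output_smul (S : StateSpace n m) (s c : ℂ) (x : Fin n → ℂ) :
    S.output s (c • x) = c • S.output s x := by
  simp only [output, Matrix.mulVec_smul]

theorem evalAt_mulVec (S : StateSpace n m) {s : ℂ}
    (h : (Matrix.scalar (Fin n) s - S.A.map (algebraMap ℝ ℂ)).det ≠ 0) (v : Fin m → ℂ) :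
    S.transferMatrix.evalAt s *ᵥ v
      = S.output s (S.B.map (algebraMap ℝ ℂ) *ᵥ v) + S.D.map (algebraMap ℝ ℂ) *ᵥ v := by
  rw [evalAt_transferMatrix S s h, Matrix.add_mulVec, output, Matrix.mulVec_mulVec,
    Matrix.mulVec_mulVec, Matrix.mul_assoc]

/-- For a controllable system the residues of `C (s - A)⁻¹ x` lie in the range of the residue of
the transfer function matrix. -/
theorem IsMinimalRealization.tendsto_output {S : StateSpace n m} {G : TransferMatrix m}
    (h : S.IsMinimalRealization G) {s₀ : ℂ} {R : Matrix (Fin m) (Fin m) ℂ}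
    (hR : Tendsto (fun s : ℂ => (s - s₀) • G.evalAt s) (𝓝[≠] s₀) (𝓝 R)) (x : Fin n → ℂ) :
    ∃ w, Tendsto (fun s : ℂ => (s - s₀) • S.output s x) (𝓝[≠] s₀) (𝓝 (R *ᵥ w)) := by
  have hsub : Tendsto (fun s : ℂ => s - s₀) (𝓝[≠] s₀) (𝓝 0) := by
    have : Continuous fun s : ℂ => s - s₀ := by fun_prop
    simpa using (this.tendsto s₀).mono_left nhdsWithin_le_nhds
  have hid : Tendsto (fun s : ℂ => s) (𝓝[≠] s₀) (𝓝 s₀) := tendsto_id.mono_left nhdsWithin_le_nhds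
  -- The states with the desired property form a subspace. It contains the range of B, where the
  -- response is G(s)v - Dv, and it is A-invariant by the resolvent identity.
  let W : Submodule ℂ (Fin n → ℂ) :=
    { carrier := {x | ∃ w, Tendsto (fun s : ℂ => (s - s₀) • S.output s x) (𝓝[≠] s₀)
        (𝓝 (R *ᵥ w))}
      add_mem' := by
        rintro a b ⟨u, hu⟩ ⟨v, hv⟩
        refine ⟨u + v, ?_⟩
        rw [Matrix.mulVec_add]
        simpa only [output_add, smul_add] using hu.add hv
      zero_mem' := ⟨0, by simp [output]⟩
      smul_mem' := by
        rintro c a ⟨u, hu⟩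
        refine ⟨c • u, ?_⟩
        rw [Matrix.mulVec_smul]
        simpa only [output_smul, smul_comm c] using hu.const_smul c }
  have hW : W = ⊤ := by
    refine h.eq_top_complex W ?_ fun v => ⟨v, ?_⟩
    · rintro a ⟨w, hw⟩
      -- C(s - A)⁻¹Aa = s C(s - A)⁻¹a - Ca, and the factor s - s₀ kills the last term in the limit.
      refine ⟨s₀ • w, ?_⟩
      have h1 := (hid.smul hw).sub (hsub.smul_const (S.C.map (algebraMap ℝ ℂ) *ᵥ a))
      rw [zero_smul, sub_zero, ← Matrix.mulVec_smul] at h1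
      refine h1.congr' ?_
      filter_upwards [S.eventually_det_ne_zero s₀] with s hs
      rw [← S.resolvent_mulVec_sub hs a, output_sub, output_smul]
      module
    · have hc : Continuous fun X : Matrix (Fin m) (Fin m) ℂ => X *ᵥ v := by fun_prop
      have h1 := ((hc.tendsto R).comp hR).sub (hsub.smul_const (S.D.map (algebraMap ℝ ℂ) *ᵥ v))
      rw [zero_smul, sub_zero] at h1
      refine h1.congr' ?_
      filter_upwards [S.eventually_det_ne_zero s₀] with s hs
      simp only [Function.comp]
      rw [← h.1, Matrix.smul_mulVec, S.evalAt_mulVec hs]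
      module
  have : x ∈ W := by rw [hW]; trivial
  exact this

end StateSpace

/-! ### Continuity of a transfer function matrix and isolation of its poles -/

namespace TransferMatrix

variable {m : ℕ}

theorem continuousAt_evalAt {G : TransferMatrix m} {s₀ : ℂ} (h : ¬ G.IsPole s₀) :
    ContinuousAt (fun s => G.evalAt s) s₀ := by
  refine continuousAt_pi.2 fun i => continuousAt_pi.2 fun j => ?_
  have hd : (G i j).denom.eval₂ (algebraMap ℝ ℂ) s₀ ≠ 0 := fun h0 => h ⟨i, j, h0⟩
  simp only [evalAt, Matrix.map_apply, RatFunc.eval]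
  simp only [← Polynomial.eval_map] at hd ⊢
  exact (Polynomial.continuous _).continuousAt.div (Polynomial.continuous _).continuousAt hd

theorem eventually_not_isPole (G : TransferMatrix m) (s₀ : ℂ) :
    ∀ᶠ s in 𝓝[≠] s₀, ¬ G.IsPole s := by
  have h : ∀ i j, ∀ᶠ s in 𝓝[≠] s₀, (G i j).denom.eval₂ (algebraMap ℝ ℂ) s ≠ 0 := by
    intro i j
    have hne : (G i j).denom.map (algebraMap ℝ ℂ) ≠ 0 := by
      simpa using (G i j).denom_ne_zero
    have hfin := Polynomial.finite_setOfPred_isRoot hne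
    have := (hfin.subset (Set.sdiff_subset (t := {s₀}))).isClosed.isOpen_compl.mem_nhds
      (show s₀ ∈ _ by simp)
    filter_upwards [mem_nhdsWithin_of_mem_nhds this, self_mem_nhdsWithin] with s hs hs' h0
    refine hs ⟨?_, hs'⟩
    rw [← Polynomial.eval_map] at h0
    exact h0
  filter_upwards [eventually_all.2 fun i => eventually_all.2 fun j => h i j] with s hs
  rintro ⟨i, j, hij⟩
  exact hs i j hij

end TransferMatrix

/-- The eigenvalues of a minimal realization are poles. -/
theorem StateSpace.IsMinimalRealization.det_ne_zero {n m : ℕ} {S : StateSpace n m}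
    {G : TransferMatrix m} (h : S.IsMinimalRealization G) {s : ℂ} (hs : ¬ G.IsPole s) :
    (Matrix.scalar (Fin n) s - S.A.map (algebraMap ℝ ℂ)).det ≠ 0 := by
  intro h0
  obtain ⟨x, hx0, hx⟩ := Matrix.exists_mulVec_eq_zero_iff.2 h0
  have hA : S.A.map (algebraMap ℝ ℂ) *ᵥ x = s • x := by
    rw [Matrix.sub_mulVec, sub_eq_zero] at hx
    rw [← hx]
    ext i
    simp [Matrix.mulVec_diagonal]
  refine hx0 (h.eq_zero_of_eigenvector hA ?_)
  have hR : Tendsto (fun z : ℂ => (z - s) • G.evalAt z) (𝓝[≠] s) (𝓝 0) := by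
    have h1 : ContinuousAt (fun z : ℂ => (z - s) • G.evalAt z) s :=
      (continuousAt_id.sub continuousAt_const).smul (TransferMatrix.continuousAt_evalAt hs)
    have h2 := h1.tendsto.mono_left (nhdsWithin_le_nhds (s := {s}ᶜ))
    simpa using h2
  obtain ⟨w, hw⟩ := h.tendsto_output hR x
  rw [Matrix.zero_mulVec] at hw
  -- For the eigenvector x, (z - s)C(z - A)⁻¹x is the constant Cx, while its limit lies in the range
  -- of the residue of G, which is 0 off the poles. Hence Cx = 0, contradicting observability.
  refine tendsto_nhds_unique (tendsto_const_nhds.congr' ?_) hw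
  filter_upwards [S.eventually_det_ne_zero s] with z hz
  rw [← S.resolvent_mulVec_sub hz, hA, ← sub_smul, S.output_smul]

/-! ### The imaginary part of the quadratic form of a matrix -/

section QuadraticForm

variable {m : ℕ}

/-- Translates both negative imaginary conditions into signs of Im v*Xv, the form in which they are
used. -/
theorem Matrix.star_dotProduct_I_smul_sub_conjTranspose (X : Matrix (Fin m) (Fin m) ℂ)
    (v : Fin m → ℂ) :
    star v ⬝ᵥ ((Complex.I • (X - Xᴴ)) *ᵥ v) = ((-2 * (star v ⬝ᵥ (X *ᵥ v)).im : ℝ) : ℂ) := by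
  have h : star v ⬝ᵥ (Xᴴ *ᵥ v) = star (star v ⬝ᵥ (X *ᵥ v)) := by
    rw [Matrix.star_dotProduct, Matrix.star_mulVec, Matrix.conjTranspose_conjTranspose,
      ← Matrix.dotProduct_mulVec]
  rw [Matrix.smul_mulVec, Matrix.sub_mulVec, dotProduct_smul, dotProduct_sub, h]
  apply Complex.ext <;> simp
  ring

theorem TransferMatrix.IsNegativeImaginary.im_nonpos {G : TransferMatrix m}
    (hG : G.IsNegativeImaginary) {ω : ℝ} (hω : 0 < ω) (h : ¬ G.IsPole (Complex.I * ω))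
    (v : Fin m → ℂ) : (star v ⬝ᵥ (G.evalAt (Complex.I * ω) *ᵥ v)).im ≤ 0 := by
  have h1 := (hG.posSemidef ω hω h).dotProduct_mulVec_nonneg v
  rw [Matrix.star_dotProduct_I_smul_sub_conjTranspose, Complex.zero_le_real] at h1
  linarith

theorem TransferMatrix.IsStrictlyNegativeImaginary.im_neg {H : TransferMatrix m}
    (hH : H.IsStrictlyNegativeImaginary) {ω : ℝ} (hω : 0 < ω) {v : Fin m → ℂ} (hv : v ≠ 0) :
    (star v ⬝ᵥ (H.evalAt (Complex.I * ω) *ᵥ v)).im < 0 := by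
  have h1 := (hH.posDef ω hω).dotProduct_mulVec_pos hv
  rw [Matrix.star_dotProduct_I_smul_sub_conjTranspose, Complex.zero_lt_real] at h1
  linarith

theorem Matrix.PosSemidef.exists_ofReal {K : Matrix (Fin m) (Fin m) ℂ} (hK : K.PosSemidef)
    (v : Fin m → ℂ) : ∃ r : ℝ, 0 ≤ r ∧ star v ⬝ᵥ (K *ᵥ v) = r := by
  have h := hK.dotProduct_mulVec_nonneg v
  rw [Complex.nonneg_iff] at h
  exact ⟨_, h.1, Complex.ext rfl (by simpa using h.2.symm)⟩

theorem im_star_dotProduct_comm (u v : Fin m → ℂ) : (star v ⬝ᵥ u).im = -(star u ⬝ᵥ v).im := by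
  rw [Matrix.star_dotProduct, dotProduct_comm, ← Complex.conj_im]
  rfl

end QuadraticForm

/-! ### Laurent expansion at a simple pole -/

/-- By removal of singularities (s - s₀)f(s) extends holomorphically with value k/s₀ at s₀; the
difference in question is its difference quotient, so the limit is its derivative. -/
theorem exists_tendsto_sub_of_simple_pole {f : ℂ → ℂ} {s₀ k : ℂ} (hs₀ : s₀ ≠ 0)
    (hf : ∀ᶠ s in 𝓝[≠] s₀, DifferentiableAt ℂ f s)
    (hk : Tendsto (fun s => (s - s₀) * s * f s) (𝓝[≠] s₀) (𝓝 k)) :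
    ∃ d, Tendsto (fun s => f s - (s₀ * (s - s₀))⁻¹ * k) (𝓝[≠] s₀) (𝓝 d) := by
  classical
  set g : ℂ → ℂ := Function.update (fun s => (s - s₀) * f s) s₀ (k / s₀) with hg
  have hgne : ∀ s, s ≠ s₀ → g s = (s - s₀) * f s := fun s hs => by
    rw [hg, Function.update_of_ne hs]
  have hgs : g s₀ = k / s₀ := by rw [hg, Function.update_self]
  have hcont : ContinuousAt g s₀ := by
    rw [hg, continuousAt_update_same]
    have h1 : Tendsto (fun s : ℂ => s) (𝓝[≠] s₀) (𝓝 s₀) := tendsto_id.mono_left nhdsWithin_le_nhds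
    refine (hk.div h1 hs₀).congr' ?_
    filter_upwards [h1.eventually_ne hs₀] with s hs
    simp only [Pi.div_apply]
    field_simp
  have hdiff : ∀ᶠ s in 𝓝[≠] s₀, DifferentiableAt ℂ g s := by
    filter_upwards [hf, self_mem_nhdsWithin] with s hs hne
    have h2 : DifferentiableAt ℂ (fun s => (s - s₀) * f s) s :=
      (differentiableAt_id.sub_const s₀).mul hs
    refine h2.congr_of_eventuallyEq ?_
    filter_upwards [isOpen_ne.mem_nhds hne] with z hz using hgne z hz
  have han := Complex.analyticAt_of_differentiable_on_punctured_nhds_of_continuousAt hdiff hcont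
  refine ⟨deriv g s₀, ((hasDerivAt_iff_tendsto_slope.1
    han.differentiableAt.hasDerivAt)).congr' ?_⟩
  filter_upwards [self_mem_nhdsWithin] with s hs
  have hs' : s - s₀ ≠ 0 := sub_ne_zero.2 hs
  rw [slope_def_field, hgne s hs, hgs]
  field_simp

/-! ### Negative imaginary matrices near the axis, and the DC gain condition -/

namespace TransferMatrix

variable {m : ℕ}

theorem eventually_differentiableAt (G : TransferMatrix m) (s₀ : ℂ) (i j : Fin m) :
    ∀ᶠ s in 𝓝[≠] s₀, DifferentiableAt ℂ (fun s => G.evalAt s i j) s := by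
  filter_upwards [G.eventually_not_isPole s₀] with s hs
  have hd : (G i j).denom.eval₂ (algebraMap ℝ ℂ) s ≠ 0 := fun h0 => hs ⟨i, j, h0⟩
  simp only [evalAt, Matrix.map_apply, RatFunc.eval]
  simp only [← Polynomial.eval_map] at hd ⊢
  exact (Polynomial.differentiable _).differentiableAt.div
    (Polynomial.differentiable _).differentiableAt hd

theorem tendsto_I_mul_nhdsNE (ω : ℝ) :
    Tendsto (fun t : ℝ => Complex.I * t) (𝓝[≠] ω) (𝓝[≠] (Complex.I * ω)) := by
  refine tendsto_nhdsWithin_iff.2 ⟨?_, ?_⟩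
  · have : Continuous fun t : ℝ => Complex.I * (t : ℂ) := by fun_prop
    exact (this.tendsto ω).mono_left nhdsWithin_le_nhds
  · filter_upwards [self_mem_nhdsWithin] with t ht h
    exact ht (by simpa using h)

/-- On the positive imaginary axis a negative imaginary `G` is the sum of a simple pole with
positive semidefinite coefficient and a part whose limit is again negative imaginary. -/
theorem IsNegativeImaginary.exists_laurent {G : TransferMatrix m} (hG : G.IsNegativeImaginary)
    {ω : ℝ} (hω : 0 < ω) : ∃ K R : Matrix (Fin m) (Fin m) ℂ, K.PosSemidef ∧
      Tendsto (fun s : ℂ => G.evalAt s - (Complex.I * ω * (s - Complex.I * ω))⁻¹ • K)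
        (𝓝[≠] (Complex.I * ω)) (𝓝 R) ∧
      ∀ v, (star v ⬝ᵥ (R *ᵥ v)).im ≤ 0 := by
  set s₀ : ℂ := Complex.I * ω with hs₀
  have hs₀' : s₀ ≠ 0 := by simp [hs₀, hω.ne']
  obtain ⟨K, hK, hpos⟩ : ∃ K : Matrix (Fin m) (Fin m) ℂ,
      Tendsto (fun s : ℂ => ((s - s₀) * s) • G.evalAt s) (𝓝[≠] s₀) (𝓝 K) ∧ K.PosSemidef := by
    -- Regular points are included by taking K = 0.
    by_cases h : G.IsPole s₀
    · exact hG.residue ω hω h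
    · refine ⟨0, ?_, Matrix.PosSemidef.zero⟩
      have h1 : ContinuousAt (fun s : ℂ => ((s - s₀) * s) • G.evalAt s) s₀ :=
        ((continuousAt_id.sub continuousAt_const).mul continuousAt_id).smul
          (continuousAt_evalAt h)
      have h2 := h1.tendsto.mono_left (nhdsWithin_le_nhds (s := {s₀}ᶜ))
      simpa using h2
  have hentry : ∀ i j, ∃ d, Tendsto (fun s => G.evalAt s i j - (s₀ * (s - s₀))⁻¹ * K i j)
      (𝓝[≠] s₀) (𝓝 d) := by
    intro i j
    refine exists_tendsto_sub_of_simple_pole hs₀' (G.eventually_differentiableAt s₀ i j) ?_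
    exact ((continuous_apply_apply i j).tendsto K).comp hK
  choose R hR using hentry
  have hlim : Tendsto (fun s : ℂ => G.evalAt s - (s₀ * (s - s₀))⁻¹ • K) (𝓝[≠] s₀)
      (𝓝 (Matrix.of R)) := tendsto_pi_nhds.2 fun i => tendsto_pi_nhds.2 fun j => hR i j
  refine ⟨K, Matrix.of R, hpos, hlim, fun v => ?_⟩
  have hc : Continuous fun X : Matrix (Fin m) (Fin m) ℂ => (star v ⬝ᵥ (X *ᵥ v)).im := by fun_prop
  have h1 := ((hc.tendsto _).comp hlim).comp (tendsto_I_mul_nhdsNE ω)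
  refine le_of_tendsto h1 ?_
  have hpole := (tendsto_I_mul_nhdsNE ω).eventually (G.eventually_not_isPole s₀)
  have hgt : ∀ᶠ t : ℝ in 𝓝[≠] ω, 0 < t := nhdsWithin_le_nhds (lt_mem_nhds hω)
  filter_upwards [hpole, hgt] with t ht ht0
  simp only [Function.comp]
  obtain ⟨r, -, hr⟩ := hpos.exists_ofReal v
  rw [Matrix.sub_mulVec, Matrix.smul_mulVec, dotProduct_sub, dotProduct_smul, hr]
  -- Along the axis the coefficient of K is real, so the polar part does not affect the imaginary
  -- part and the sign passes from G to R.
  have hreal : (s₀ * (Complex.I * t - s₀))⁻¹ • (r : ℂ) = (((-(ω * (t - ω)))⁻¹ * r : ℝ) : ℂ) := by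
    rw [hs₀, show Complex.I * ω * (Complex.I * t - Complex.I * ω)
      = (Complex.I * Complex.I) * (ω * (t - ω)) by ring, Complex.I_mul_I]
    push_cast
    rw [smul_eq_mul]
    ring
  rw [hreal, Complex.sub_im, Complex.ofReal_im, sub_zero]
  exact hG.im_nonpos ht0 ht v

/-- The number being inverted has imaginary part ω Re s. This gives the polar part of G the
favourable sign in the right half plane. -/
theorem im_inv_nonpos {ω : ℝ} (hω : 0 < ω) {s : ℂ} (hs : 0 ≤ s.re) :
    ((Complex.I * ω * (s - Complex.I * ω))⁻¹).im ≤ 0 := by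
  rw [Complex.inv_im]
  apply div_nonpos_of_nonpos_of_nonneg _ (Complex.normSq_nonneg _)
  simp
  positivity

/-- If the DC gain condition holds then `1` is not an eigenvalue of `t G(0) H(0)`. -/
theorem eq_zero_of_lambdaMax_lt_one {G H : TransferMatrix m}
    (h : lambdaMax (G.dcGain * H.dcGain) < 1) {t : ℝ} (ht : t ∈ Set.Icc (0 : ℝ) 1)
    {u : Fin m → ℂ} (hu : u = (t : ℂ) • (G.evalAt 0 *ᵥ (H.evalAt 0 *ᵥ u))) : u = 0 := by
  by_contra hu0
  set M := G.dcGain * H.dcGain with hM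
  have ht0 : t ≠ 0 := by
    rintro rfl
    apply hu0
    rw [hu]
    simp
  have hMc : M.map (algebraMap ℝ ℂ) = G.evalAt 0 * H.evalAt 0 := by
    rw [hM, Matrix.map_mul, map_dcGain, map_dcGain]
  have hdet : (Matrix.scalar (Fin m) ((t⁻¹ : ℝ) : ℂ) - M.map (algebraMap ℝ ℂ)).det = 0 := by
    refine Matrix.exists_mulVec_eq_zero_iff.1 ⟨u, hu0, ?_⟩
    rw [hMc, Matrix.sub_mulVec, ← Matrix.mulVec_mulVec, sub_eq_zero]
    have : Matrix.scalar (Fin m) ((t⁻¹ : ℝ) : ℂ) *ᵥ u = ((t⁻¹ : ℝ) : ℂ) • u := by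
      ext i
      simp [Matrix.mulVec_diagonal]
    rw [this]
    nth_rewrite 1 [hu]
    rw [smul_smul, ← Complex.ofReal_mul, inv_mul_cancel₀ ht0, Complex.ofReal_one, one_smul]
  have hroot : t⁻¹ ∈ spectrum ℝ M := by
    rw [Matrix.mem_spectrum_iff_isRoot_charpoly, Polynomial.IsRoot]
    have h1 := StateSpace.charpoly_eval₂ (algebraMap ℝ ℂ) ((t⁻¹ : ℝ) : ℂ) M
    rw [hdet] at h1
    have h2 := Polynomial.hom_eval₂ M.charpoly (RingHom.id ℝ) (algebraMap ℝ ℂ) t⁻¹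
    rw [RingHom.comp_id] at h2
    rw [show ((algebraMap ℝ ℂ) t⁻¹) = ((t⁻¹ : ℝ) : ℂ) from rfl, h1] at h2
    exact (map_eq_zero (algebraMap ℝ ℂ)).1 h2
  have hfin : (spectrum ℝ M).Finite := Matrix.finite_spectrum M
  have h1 : t⁻¹ ≤ lambdaMax M := le_csSup hfin.bddAbove hroot
  have h2 : 1 ≤ t⁻¹ := (one_le_inv₀ (lt_of_le_of_ne ht.1 ht0.symm)).2 ht.2
  linarith

end TransferMatrix

/-! ### Eigenvalues of complex matrices -/

section Eigenvalues

variable {ι : Type*} [Fintype ι] [DecidableEq ι]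

theorem Matrix.scalar_mulVec (s : ℂ) (v : ι → ℂ) : Matrix.scalar ι s *ᵥ v = s • v := by
  ext i
  simp [Matrix.mulVec_diagonal]

theorem Matrix.det_scalar_sub_eq_zero_iff (M : Matrix ι ι ℂ) (s : ℂ) :
    (Matrix.scalar ι s - M).det = 0 ↔ ∃ v, v ≠ 0 ∧ M *ᵥ v = s • v := by
  rw [← Matrix.exists_mulVec_eq_zero_iff]
  refine exists_congr fun v => and_congr_right fun _ => ?_
  rw [Matrix.sub_mulVec, Matrix.scalar_mulVec, sub_eq_zero, eq_comm]

/-- Allows eigenvalues to be moved to the upper half plane, since the hypotheses on G and H concern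
ω > 0 only. -/
theorem Matrix.det_scalar_conj_sub (M : Matrix ι ι ℝ) {s : ℂ}
    (h : (Matrix.scalar ι s - M.map (algebraMap ℝ ℂ)).det = 0) :
    (Matrix.scalar ι (star s) - M.map (algebraMap ℝ ℂ)).det = 0 := by
  rw [Matrix.det_scalar_sub_eq_zero_iff] at h ⊢
  obtain ⟨v, hv, hMv⟩ := h
  refine ⟨star v, star_ne_zero.2 hv, ?_⟩
  have h1 := congrArg star hMv
  rw [star_smul] at h1
  rw [← h1]
  ext i
  simp [Matrix.mulVec, dotProduct]

theorem Matrix.norm_le_of_det_scalar_sub_eq_zero (M : Matrix ι ι ℂ) {s : ℂ}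
    (h : (Matrix.scalar ι s - M).det = 0) : ‖s‖ ≤ ∑ i, ∑ j, ‖M i j‖ := by
  obtain ⟨v, hv, hMv⟩ := (Matrix.det_scalar_sub_eq_zero_iff M s).1 h
  have hv' : 0 < ‖v‖ := norm_pos_iff.2 hv
  refine le_of_mul_le_mul_right ?_ hv'
  rw [← norm_smul, ← hMv, pi_norm_le_iff_of_nonneg (by positivity)]
  intro i
  calc ‖(M *ᵥ v) i‖ ≤ ∑ j, ‖M i j * v j‖ := norm_sum_le _ _
    _ ≤ ∑ j, ‖M i j‖ * ‖v‖ := Finset.sum_le_sum fun j _ => by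
        rw [norm_mul]
        gcongr
        exact norm_le_pi_norm v j
    _ = (∑ j, ‖M i j‖) * ‖v‖ := by rw [Finset.sum_mul]
    _ ≤ _ := mul_le_mul_of_nonneg_right
        (Finset.single_le_sum (f := fun i => ∑ j, ‖M i j‖) (fun i _ => by positivity)
          (Finset.mem_univ i)) hv'.le

/-- Each factor is at least the distance Re s from s to the imaginary axis. Applied to the roots of
a characteristic polynomial, it shows that a small determinant at s forces a root in the open right
half plane. -/
theorem Multiset.pow_card_le_norm_prod_sub {s : ℂ} (hs : 0 ≤ s.re) (r : Multiset ℂ)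
    (hr : ∀ z ∈ r, z.re ≤ 0) : s.re ^ r.card ≤ ‖(r.map fun z => s - z).prod‖ := by
  induction r using Multiset.induction with
  | empty => simp
  | cons a r ih =>
    rw [Multiset.map_cons, Multiset.prod_cons, norm_mul, Multiset.card_cons, pow_succ']
    have h1 := ih fun z hz => hr z (Multiset.mem_cons_of_mem hz)
    have h2 : s.re ≤ ‖s - a‖ := by
      have := Complex.re_le_norm (s - a)
      have := hr a (Multiset.mem_cons_self a r)
      rw [Complex.sub_re] at *
      linarith
    exact mul_le_mul h2 h1 (by positivity) (norm_nonneg _)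

/-- Having an eigenvalue in the open right half plane is an open condition. -/
theorem Matrix.isOpen_exists_eigenvalue_re_pos {X : Type*} [TopologicalSpace X]
    {M : X → Matrix ι ι ℂ} (hM : Continuous M) :
    IsOpen {t | ∃ s : ℂ, 0 < s.re ∧ (Matrix.scalar ι s - M t).det = 0} := by
  rw [isOpen_iff_mem_nhds]
  rintro t₀ ⟨s, hs, h0⟩
  have hc : Continuous fun t => ‖(Matrix.scalar ι s - M t).det‖ := by fun_prop
  have hlt : ∀ᶠ t in 𝓝 t₀, ‖(Matrix.scalar ι s - M t).det‖ < s.re ^ Fintype.card ι := by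
    refine hc.continuousAt.eventually_lt continuousAt_const ?_
    rw [h0, norm_zero]
    positivity
  filter_upwards [hlt] with t ht
  by_contra hcon
  have hsp : (M t).charpoly.Splits := IsAlgClosed.splits _
  have hroots := hsp.eval_eq_prod_roots_of_monic (M t).charpoly_monic s
  have hcard : (M t).charpoly.roots.card = Fintype.card ι := by
    rw [← hsp.natDegree_eq_card_roots, Matrix.charpoly_natDegree_eq_dim]
  have h1 := Multiset.pow_card_le_norm_prod_sub hs.le (M t).charpoly.roots fun z hz => by
    by_contra hz0
    refine hcon ⟨z, not_le.1 hz0, ?_⟩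
    rw [← Matrix.eval_charpoly]
    exact (Polynomial.mem_roots'.1 hz).2
  rw [← hroots, hcard, Matrix.eval_charpoly] at h1
  linarith

end Eigenvalues

/-! ### The closed loop -/

namespace StateSpace

variable {m n n₁ n₂ : ℕ}

/-- The system with its output multiplied by `t`. -/
def scaleOutput (S : StateSpace n m) (t : ℝ) : StateSpace n m := ⟨S.A, S.B, t • S.C, t • S.D⟩

theorem closedLoop_of_mul_eq_zero (S₁ : StateSpace n₁ m) (S₂ : StateSpace n₂ m)
    (hD : S₁.D * S₂.D = 0) : S₁.closedLoop S₂ = Matrix.fromBlocks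
      (S₁.A + S₁.B * S₂.D * S₁.C) (S₁.B * (1 + S₂.D * S₁.D) * S₂.C)
      (S₂.B * S₁.C) (S₂.A + S₂.B * S₁.D * S₂.C) := by
  simp [closedLoop, hD]

theorem continuous_closedLoop_scaleOutput (S₁ : StateSpace n₁ m) (S₂ : StateSpace n₂ m)
    (hD : S₁.D * S₂.D = 0) :
    Continuous fun t : ℝ => (S₁.closedLoop (S₂.scaleOutput t)).map (algebraMap ℝ ℂ) := by
  have h : ∀ t : ℝ, S₁.closedLoop (S₂.scaleOutput t) = Matrix.fromBlocks
      (S₁.A + S₁.B * (t • S₂.D) * S₁.C) (S₁.B * (1 + (t • S₂.D) * S₁.D) * (t • S₂.C))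
      (S₂.B * S₁.C) (S₂.A + S₂.B * S₁.D * (t • S₂.C)) := fun t =>
    closedLoop_of_mul_eq_zero _ _ (by simp [scaleOutput, hD])
  simp only [h]
  refine Continuous.matrix_map ?_ Complex.continuous_ofReal
  refine Continuous.matrix_fromBlocks ?_ ?_ ?_ ?_ <;> fun_prop

theorem exists_signals_of_closedLoop_mulVec (S₁ : StateSpace n₁ m) (S₂ : StateSpace n₂ m)
    (hD : S₁.D * S₂.D = 0) {s : ℂ}
    (h : (Matrix.scalar _ s - (S₁.closedLoop S₂).map (algebraMap ℝ ℂ)).det = 0) :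
    ∃ (x₁ : Fin n₁ → ℂ) (x₂ : Fin n₂ → ℂ) (y₁ y₂ : Fin m → ℂ), (x₁ = 0 → x₂ ≠ 0) ∧
      S₁.A.map (algebraMap ℝ ℂ) *ᵥ x₁ + S₁.B.map (algebraMap ℝ ℂ) *ᵥ y₂ = s • x₁ ∧
      S₂.A.map (algebraMap ℝ ℂ) *ᵥ x₂ + S₂.B.map (algebraMap ℝ ℂ) *ᵥ y₁ = s • x₂ ∧
      S₁.C.map (algebraMap ℝ ℂ) *ᵥ x₁ + S₁.D.map (algebraMap ℝ ℂ) *ᵥ y₂ = y₁ ∧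
      S₂.C.map (algebraMap ℝ ℂ) *ᵥ x₂ + S₂.D.map (algebraMap ℝ ℂ) *ᵥ y₁ = y₂ := by
  obtain ⟨z, hz0, hz⟩ := (Matrix.det_scalar_sub_eq_zero_iff _ _).1 h
  set φ := algebraMap ℝ ℂ
  set x₁ : Fin n₁ → ℂ := z ∘ Sum.inl
  set x₂ : Fin n₂ → ℂ := z ∘ Sum.inr
  have hadd : ∀ {p q : ℕ} (X Y : Matrix (Fin p) (Fin q) ℝ), (X + Y).map φ = X.map φ + Y.map φ :=
    fun X Y => Matrix.map_add _ (map_add φ) X Y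
  have hone : (1 : Matrix (Fin m) (Fin m) ℝ).map φ = 1 :=
    Matrix.map_one _ (map_zero φ) (map_one φ)
  have hDc : S₁.D.map φ * S₂.D.map φ = 0 := by
    rw [← Matrix.map_mul, hD]
    exact Matrix.map_zero _ (map_zero φ)
  rw [closedLoop_of_mul_eq_zero _ _ hD, Matrix.fromBlocks_map, Matrix.fromBlocks_mulVec] at hz
  have h1 : _ = (s • z) ∘ Sum.inl := congrArg (· ∘ Sum.inl) hz
  have h2 : _ = (s • z) ∘ Sum.inr := congrArg (· ∘ Sum.inr) hz
  rw [Sum.elim_comp_inl] at h1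
  rw [Sum.elim_comp_inr] at h2
  simp only [hadd, Matrix.map_mul, hone] at h1 h2
  -- The D₂y₁ part of y₂ does not feed back into y₁, because D₁D₂ = 0.
  set y₁ := S₁.C.map φ *ᵥ x₁ + S₁.D.map φ *ᵥ (S₂.C.map φ *ᵥ x₂) with hy₁
  refine ⟨x₁, x₂, y₁, S₂.C.map φ *ᵥ x₂ + S₂.D.map φ *ᵥ y₁, ?_, ?_, ?_, ?_, rfl⟩
  · intro e1 e2
    apply hz0
    ext i
    rcases i with i | i
    · exact congrFun e1 i
    · exact congrFun e2 i
  · refine Eq.trans ?_ h1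
    simp only [hy₁, Matrix.mulVec_add, Matrix.add_mulVec, ← Matrix.mulVec_mulVec, Matrix.mul_add,
      Matrix.add_mul, Matrix.mul_one, Matrix.mul_assoc, x₁, x₂]
    abel
  · refine Eq.trans ?_ h2
    simp only [hy₁, Matrix.mulVec_add, Matrix.add_mulVec, ← Matrix.mulVec_mulVec,
      Matrix.mul_assoc, x₁, x₂]
    abel
  · rw [Matrix.mulVec_add, Matrix.mulVec_mulVec y₁, hDc, Matrix.zero_mulVec, add_zero]

theorem evalAt_mulVec_of_state_eq (S : StateSpace n m) {s : ℂ}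
    (h : (Matrix.scalar (Fin n) s - S.A.map (algebraMap ℝ ℂ)).det ≠ 0) {x : Fin n → ℂ}
    {u : Fin m → ℂ}
    (hx : S.A.map (algebraMap ℝ ℂ) *ᵥ x + S.B.map (algebraMap ℝ ℂ) *ᵥ u = s • x) :
    S.C.map (algebraMap ℝ ℂ) *ᵥ x + S.D.map (algebraMap ℝ ℂ) *ᵥ u
      = S.transferMatrix.evalAt s *ᵥ u := by
  rw [S.evalAt_mulVec h, ← S.resolvent_mulVec_sub h x, ← hx, add_sub_cancel_left]

theorem state_eq_zero (S : StateSpace n m) {s : ℂ}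
    (h : (Matrix.scalar (Fin n) s - S.A.map (algebraMap ℝ ℂ)).det ≠ 0) {x : Fin n → ℂ}
    (hx : S.A.map (algebraMap ℝ ℂ) *ᵥ x + S.B.map (algebraMap ℝ ℂ) *ᵥ (0 : Fin m → ℂ) = s • x) :
    x = 0 := by
  by_contra hx0
  refine h ((Matrix.det_scalar_sub_eq_zero_iff _ _).2 ⟨x, hx0, ?_⟩)
  rwa [Matrix.mulVec_zero, add_zero] at hx

/-- Away from the poles, an eigenvalue of the closed loop gives a nontrivial signal circulating
in the loop. -/
theorem exists_loop_signal {G H : TransferMatrix m} {S₁ : StateSpace n₁ m} {S₂ : StateSpace n₂ m}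
    (hS₁ : S₁.IsMinimalRealization G) (hS₂ : S₂.IsMinimalRealization H)
    (hD : S₁.D * S₂.D = 0) {s : ℂ} (hGs : ¬ G.IsPole s) (hHs : ¬ H.IsPole s) {t : ℝ}
    (h : (Matrix.scalar _ s
      - (S₁.closedLoop (S₂.scaleOutput t)).map (algebraMap ℝ ℂ)).det = 0) :
    ∃ u : Fin m → ℂ, ‖u‖ = 1 ∧ u = (t : ℂ) • (G.evalAt s *ᵥ (H.evalAt s *ᵥ u)) := by
  have hd₁ := hS₁.det_ne_zero hGs
  have hd₂ := hS₂.det_ne_zero hHs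
  obtain ⟨x₁, x₂, y₁, y₂, hne, hx₁, hx₂, hy₁, hy₂⟩ :=
    exists_signals_of_closedLoop_mulVec S₁ (S₂.scaleOutput t) (by simp [scaleOutput, hD]) h
  have hsmul : ∀ {p q : ℕ} (X : Matrix (Fin p) (Fin q) ℝ),
      (t • X).map (algebraMap ℝ ℂ) = (t : ℂ) • X.map (algebraMap ℝ ℂ) := fun X => by
    ext; simp
  simp only [scaleOutput] at hx₂ hy₂
  rw [hsmul, hsmul, Matrix.smul_mulVec, Matrix.smul_mulVec, ← smul_add,
    evalAt_mulVec_of_state_eq S₂ hd₂ hx₂, hS₂.1] at hy₂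
  rw [evalAt_mulVec_of_state_eq S₁ hd₁ hx₁, hS₁.1] at hy₁
  -- If y₁ = 0 then y₂ = 0, and both states are annihilated by invertible matrices s - Aᵢ.
  have hy0 : y₁ ≠ 0 := by
    rintro rfl
    rw [Matrix.mulVec_zero, smul_zero] at hy₂
    subst hy₂
    exact hne (S₁.state_eq_zero hd₁ hx₁) (S₂.state_eq_zero hd₂ hx₂)
  have hloop : (t : ℂ) • (G.evalAt s *ᵥ (H.evalAt s *ᵥ y₁)) = y₁ := by
    rw [← Matrix.mulVec_smul, hy₂, hy₁]
  refine ⟨((‖y₁‖⁻¹ : ℝ) : ℂ) • y₁, ?_, ?_⟩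
  · rw [norm_smul, Complex.norm_real, norm_inv, norm_norm, inv_mul_cancel₀ (norm_ne_zero_iff.2 hy0)]
  · rw [Matrix.mulVec_smul, Matrix.mulVec_smul, smul_comm, hloop]

end StateSpace

/-! ### Stability -/

section Stability

variable {m n₁ n₂ : ℕ} {G H : TransferMatrix m}

theorem Matrix.tendsto_mulVec {ι : Type*} {l : Filter ι} {X : ι → Matrix (Fin m) (Fin m) ℂ}
    {X₀ : Matrix (Fin m) (Fin m) ℂ} {v : ι → Fin m → ℂ} {v₀ : Fin m → ℂ}
    (hX : Tendsto X l (𝓝 X₀)) (hv : Tendsto v l (𝓝 v₀)) :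
    Tendsto (fun k => X k *ᵥ v k) l (𝓝 (X₀ *ᵥ v₀)) := by
  have hc : Continuous fun p : Matrix (Fin m) (Fin m) ℂ × (Fin m → ℂ) => p.1 *ᵥ p.2 := by fun_prop
  have h := (hc.tendsto (X₀, v₀)).comp (hX.prodMk_nhds hv)
  exact h

theorem tendsto_im_star_dotProduct {ι : Type*} {l : Filter ι} {u v : ι → Fin m → ℂ}
    {u₀ v₀ : Fin m → ℂ} (hu : Tendsto u l (𝓝 u₀)) (hv : Tendsto v l (𝓝 v₀)) :
    Tendsto (fun k => (star (u k) ⬝ᵥ v k).im) l (𝓝 (star u₀ ⬝ᵥ v₀).im) := by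
  have hc : Continuous fun p : (Fin m → ℂ) × (Fin m → ℂ) => (star p.1 ⬝ᵥ p.2).im := by fun_prop
  have h := (hc.tendsto (u₀, v₀)).comp (hu.prodMk_nhds hv)
  exact h

/-- Circulating signals at frequencies in the open right half plane do not accumulate at the
origin. -/
theorem limit_ne_zero_of_loop_signal (hG : G.IsNegativeImaginary)
    (hH : H.IsStrictlyNegativeImaginary) (hdc : lambdaMax (G.dcGain * H.dcGain) < 1)
    {t : ℕ → ℝ} {s : ℕ → ℂ} {u : ℕ → Fin m → ℂ} {t₀ : ℝ} {s₀ : ℂ} {u₀ : Fin m → ℂ}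
    (ht : Tendsto t atTop (𝓝 t₀)) (hs : Tendsto s atTop (𝓝 s₀)) (hu : Tendsto u atTop (𝓝 u₀))
    (ht₀ : t₀ ∈ Set.Icc (0 : ℝ) 1) (hu₀ : u₀ ≠ 0)
    (hloop : ∀ k, u k = (t k : ℂ) • (G.evalAt (s k) *ᵥ (H.evalAt (s k) *ᵥ u k))) : s₀ ≠ 0 := by
  rintro rfl
  have hGlim := (TransferMatrix.continuousAt_evalAt hG.not_isPole_zero).tendsto.comp hs
  have hHlim := (TransferMatrix.continuousAt_evalAt
    (hH.not_isPole_of_re_nonneg 0 le_rfl)).tendsto.comp hs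
  have htc : Tendsto (fun k => (t k : ℂ)) atTop (𝓝 (t₀ : ℂ)) :=
    (Complex.continuous_ofReal.tendsto t₀).comp ht
  have h1 := htc.smul (Matrix.tendsto_mulVec hGlim (Matrix.tendsto_mulVec hHlim hu))
  have h2 := tendsto_nhds_unique hu (h1.congr fun k => (hloop k).symm)
  exact hu₀ (TransferMatrix.eq_zero_of_lambdaMax_lt_one hdc ht₀ h2)

/-- Circulating signals at frequencies in the open right half plane do not accumulate at a point
of the positive imaginary axis. -/
theorem limit_ne_I_mul_of_loop_signal (hG : G.IsNegativeImaginary)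
    (hH : H.IsStrictlyNegativeImaginary)
    {t : ℕ → ℝ} {s : ℕ → ℂ} {u : ℕ → Fin m → ℂ} {t₀ : ℝ} {s₀ : ℂ} {u₀ : Fin m → ℂ}
    (ht : Tendsto t atTop (𝓝 t₀)) (hs : Tendsto s atTop (𝓝 s₀)) (hu : Tendsto u atTop (𝓝 u₀))
    (ht0 : ∀ k, 0 ≤ t k) (hs0 : ∀ k, 0 < (s k).re) (hu₀ : u₀ ≠ 0)
    (hloop : ∀ k, u k = (t k : ℂ) • (G.evalAt (s k) *ᵥ (H.evalAt (s k) *ᵥ u k)))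
    {ω : ℝ} (hω : 0 < ω) : s₀ ≠ Complex.I * ω := by
  rintro rfl
  obtain ⟨K, R, hK, hR, hRneg⟩ := hG.exists_laurent hω
  have hs' : Tendsto s atTop (𝓝[≠] (Complex.I * ω)) := by
    refine tendsto_nhdsWithin_iff.2 ⟨hs, Eventually.of_forall fun k h => ?_⟩
    have := hs0 k
    rw [show s k = Complex.I * ω from h] at this
    simp at this
  have hHlim := (TransferMatrix.continuousAt_evalAt
    (hH.not_isPole_of_re_nonneg (Complex.I * ω) (by simp))).tendsto.comp hs
  have hv := Matrix.tendsto_mulVec hHlim hu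
  set v : ℕ → Fin m → ℂ := fun k => H.evalAt (s k) *ᵥ u k
  have h1 := ht.mul (tendsto_im_star_dotProduct hv (Matrix.tendsto_mulVec (hR.comp hs') hv))
  have h2 := tendsto_im_star_dotProduct hv hu
  -- G itself may blow up along the sequence, so its polar part is dropped before the limit: it
  -- contributes a nonpositive amount to Im v*Gv.
  have hle := le_of_tendsto_of_tendsto' h2 h1 fun k => by
    obtain ⟨r, hr0, hr⟩ := hK.exists_ofReal (v k)
    have hc := TransferMatrix.im_inv_nonpos hω (hs0 k).le
    have hu' : u k = (t k : ℂ) • (G.evalAt (s k) *ᵥ v k) := hloop k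
    change (star (v k) ⬝ᵥ u k).im ≤ t k * (star (v k) ⬝ᵥ
      ((G.evalAt (s k) - (Complex.I * ω * (s k - Complex.I * ω))⁻¹ • K) *ᵥ v k)).im
    rw [hu', dotProduct_smul, smul_eq_mul, Complex.im_ofReal_mul,
      Matrix.sub_mulVec, Matrix.smul_mulVec, dotProduct_sub, dotProduct_smul, hr, Complex.sub_im,
      smul_eq_mul, mul_comm _ (r : ℂ), Complex.im_ofReal_mul]
    refine mul_le_mul_of_nonneg_left ?_ (ht0 k)
    nlinarith
  have ht₀ : 0 ≤ t₀ := ge_of_tendsto' ht ht0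
  have h3 := hH.im_neg hω hu₀
  rw [im_star_dotProduct_comm] at hle
  have h4 := mul_nonpos_of_nonneg_of_nonpos ht₀ (hRneg (H.evalAt (Complex.I * ω) *ᵥ u₀))
  linarith

/-- The closed loop has no eigenvalue in the open right half plane. -/
theorem closedLoop_det_ne_zero_of_re_pos (hG : G.IsNegativeImaginary)
    (hH : H.IsStrictlyNegativeImaginary) {S₁ : StateSpace n₁ m} {S₂ : StateSpace n₂ m}
    (hS₁ : S₁.IsMinimalRealization G) (hS₂ : S₂.IsMinimalRealization H)
    (hD : S₁.D * S₂.D = 0) (hdc : lambdaMax (G.dcGain * H.dcGain) < 1) {s : ℂ} (hs : 0 < s.re) :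
    (Matrix.scalar _ s - (S₁.closedLoop (S₂.scaleOutput 1)).map (algebraMap ℝ ℂ)).det ≠ 0 := by
  set M : unitInterval → Matrix (Fin n₁ ⊕ Fin n₂) (Fin n₁ ⊕ Fin n₂) ℂ :=
    fun t => (S₁.closedLoop (S₂.scaleOutput t)).map (algebraMap ℝ ℂ) with hMdef
  have hM : Continuous M :=
    (StateSpace.continuous_closedLoop_scaleOutput S₁ S₂ hD).comp continuous_subtype_val
  set T : Set unitInterval := {t | ∃ s : ℂ, 0 < s.re ∧ (Matrix.scalar _ s - M t).det = 0} with hT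
  have hsig : ∀ (t : unitInterval) (s : ℂ), 0 < s.re → (Matrix.scalar _ s - M t).det = 0 →
      ∃ u : Fin m → ℂ, ‖u‖ = 1 ∧
        u = ((t : ℝ) : ℂ) • (G.evalAt s *ᵥ (H.evalAt s *ᵥ u)) := fun t s hs h =>
    StateSpace.exists_loop_signal hS₁ hS₂ hD (hG.not_isPole_of_re_pos s hs)
      (hH.not_isPole_of_re_nonneg s hs.le) h
  have hclosed : IsClosed T := by
    refine IsSeqClosed.isClosed fun t t₀ htT ht => ?_
    have hex : ∀ k, ∃ s : ℂ, 0 < s.re ∧ 0 ≤ s.im ∧ (Matrix.scalar _ s - M (t k)).det = 0 := by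
      intro k
      obtain ⟨s, hs, h⟩ := htT k
      rcases le_total 0 s.im with him | him
      · exact ⟨s, hs, him, h⟩
      · exact ⟨star s, by simpa using hs, by simpa using him, Matrix.det_scalar_conj_sub _ h⟩
    choose s hsre hsim hsdet using hex
    choose u hunorm hloop using fun k => hsig (t k) (s k) (hsre k) (hsdet k)
    -- Compactness of [0,1] bounds the eigenvalues uniformly in t, so none escapes to infinity and a
    -- subsequence of eigenvalues and unit signals converges.
    obtain ⟨B, hB⟩ : ∃ B, ∀ t : unitInterval, ∑ i, ∑ j, ‖M t i j‖ ≤ B := by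
      have hc : Continuous fun t => ∑ i, ∑ j, ‖M t i j‖ := by
        refine continuous_finsetSum _ fun i _ => continuous_finsetSum _ fun j _ => ?_
        exact ((continuous_apply_apply i j).comp hM).norm
      obtain ⟨B, hB⟩ := (isCompact_range hc).bddAbove
      exact ⟨B, fun t => hB ⟨t, rfl⟩⟩
    have hsB : ∀ k, (s k, u k) ∈
        Metric.closedBall (0 : ℂ) B ×ˢ Metric.sphere (0 : Fin m → ℂ) 1 := fun k =>
      ⟨by simpa using (Matrix.norm_le_of_det_scalar_sub_eq_zero _ (hsdet k)).trans (hB _),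
        by simpa using hunorm k⟩
    obtain ⟨⟨s₀, u₀⟩, hmem, φ, hφ, hlim⟩ :=
      ((isCompact_closedBall (0 : ℂ) B).prod (isCompact_sphere (0 : Fin m → ℂ) 1)).tendsto_subseq
        hsB
    have hslim : Tendsto (s ∘ φ) atTop (𝓝 s₀) := (continuous_fst.tendsto _).comp hlim
    have hulim : Tendsto (u ∘ φ) atTop (𝓝 u₀) := (continuous_snd.tendsto _).comp hlim
    have htlim : Tendsto (fun k => (t (φ k) : ℝ)) atTop (𝓝 (t₀ : ℝ)) :=
      (continuous_subtype_val.tendsto t₀).comp (ht.comp hφ.tendsto_atTop)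
    have hu₀ : u₀ ≠ 0 := by
      have : ‖u₀‖ = 1 := by simpa using hmem.2
      rintro rfl
      simp at this
    have hre : 0 ≤ s₀.re := ge_of_tendsto'
      ((Complex.continuous_re.tendsto s₀).comp hslim) fun k => (hsre _).le
    have him : 0 ≤ s₀.im := ge_of_tendsto'
      ((Complex.continuous_im.tendsto s₀).comp hslim) fun k => hsim _
    have hdet : (Matrix.scalar _ s₀ - M t₀).det = 0 := by
      have hc : Continuous fun p : ℂ × unitInterval => (p.1 • 1 - M p.2).det :=
        Continuous.matrix_det ((continuous_fst.smul continuous_const).sub (hM.comp continuous_snd))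
      have h1 := (hc.tendsto (s₀, t₀)).comp (hslim.prodMk_nhds (ht.comp hφ.tendsto_atTop))
      have hsc : ∀ z : ℂ, Matrix.scalar (Fin n₁ ⊕ Fin n₂) z = z • 1 := fun z => by
        rw [Matrix.smul_one_eq_diagonal]; rfl
      rw [hsc]
      refine tendsto_nhds_unique h1 (tendsto_const_nhds.congr fun k => ?_)
      simpa only [hsc, Function.comp] using (hsdet (φ k)).symm
    refine ⟨s₀, lt_of_le_of_ne hre fun hre0 => ?_, hdet⟩
    rcases him.eq_or_lt with him0 | him0
    · exact limit_ne_zero_of_loop_signal hG hH hdc htlim hslim hulim t₀.2 hu₀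
        (fun k => hloop (φ k)) (Complex.ext hre0.symm him0.symm)
    · refine limit_ne_I_mul_of_loop_signal hG hH htlim hslim hulim (fun k => (t (φ k)).2.1)
        (fun k => hsre _) hu₀ (fun k => hloop (φ k)) him0 ?_
      apply Complex.ext <;> simp [← hre0]
  have hclopen : IsClopen T := ⟨hclosed, Matrix.isOpen_exists_eigenvalue_re_pos hM⟩
  intro h
  rcases isClopen_iff.1 hclopen with hempty | huniv
  · have : (1 : unitInterval) ∈ T := ⟨s, hs, by simpa [hMdef] using h⟩
    rw [hempty] at this
    exact this
  · obtain ⟨s, hs, h⟩ : (0 : unitInterval) ∈ T := by rw [huniv]; trivial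
    obtain ⟨u, hu, hu0⟩ := hsig 0 s hs h
    rw [Set.Icc.coe_zero, Complex.ofReal_zero, zero_smul] at hu0
    rw [hu0, norm_zero] at hu
    exact zero_ne_one hu

/-- The closed loop has no eigenvalue on the positive imaginary axis, not even at a pole of
`G`. -/
theorem closedLoop_det_ne_zero_of_pos (hG : G.IsNegativeImaginary)
    (hH : H.IsStrictlyNegativeImaginary) {S₁ : StateSpace n₁ m} {S₂ : StateSpace n₂ m}
    (hS₁ : S₁.IsMinimalRealization G) (hS₂ : S₂.IsMinimalRealization H)
    (hD : S₁.D * S₂.D = 0) {ω : ℝ} (hω : 0 < ω) :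
    (Matrix.scalar _ (Complex.I * ω)
      - (S₁.closedLoop S₂).map (algebraMap ℝ ℂ)).det ≠ 0 := by
  intro h
  set s₀ : ℂ := Complex.I * ω with hs₀
  have hs₀' : s₀ ≠ 0 := by simp [hs₀, hω.ne']
  have hd₂ := hS₂.det_ne_zero (hH.not_isPole_of_re_nonneg s₀ (by simp [hs₀]))
  obtain ⟨x₁, x₂, y, u, hne, hx₁, hx₂, hy, hu⟩ :=
    StateSpace.exists_signals_of_closedLoop_mulVec S₁ S₂ hD h
  rw [StateSpace.evalAt_mulVec_of_state_eq S₂ hd₂ hx₂, hS₂.1] at hu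
  obtain ⟨K, R, hK, hR, hRneg⟩ := hG.exists_laurent hω
  have hsub : Tendsto (fun s : ℂ => s - s₀) (𝓝[≠] s₀) (𝓝 0) := by
    have : Continuous fun s : ℂ => s - s₀ := by fun_prop
    simpa using (this.tendsto s₀).mono_left nhdsWithin_le_nhds
  have hres : Tendsto (fun s : ℂ => (s - s₀) • G.evalAt s) (𝓝[≠] s₀) (𝓝 (s₀⁻¹ • K)) := by
    have h1 := (hsub.smul hR).add_const (s₀⁻¹ • K)
    rw [zero_smul, zero_add] at h1
    refine h1.congr' ?_
    filter_upwards [self_mem_nhdsWithin] with s hs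
    have hs' : s - s₀ ≠ 0 := sub_ne_zero.2 hs
    rw [smul_sub, smul_smul, mul_inv, mul_left_comm, mul_inv_cancel₀ hs', mul_one, sub_add_cancel]
  obtain ⟨w, hw⟩ := hS₁.tendsto_output hres x₁
  -- From (s₀ - A₁)x₁ = B₁u one gets (s - A₁)x₁ = B₁u + (s - s₀)x₁. This expresses y through values
  -- of G near s₀, where G may have a pole.
  have hyG : ∀ᶠ s in 𝓝[≠] s₀, y = G.evalAt s *ᵥ u + (s - s₀) • S₁.output s x₁ := by
    filter_upwards [S₁.eventually_det_ne_zero s₀] with s hs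
    rw [← hS₁.1, S₁.evalAt_mulVec hs, ← hy, ← S₁.resolvent_mulVec_sub hs x₁, ← S₁.output_smul,
      add_right_comm, ← S₁.output_add]
    congr 2
    rw [sub_smul, ← hx₁]
    abel
  -- Multiplying the previous identity by s - s₀ and letting s tend to s₀ leaves only the residue of
  -- G applied to u.
  have hKu : K *ᵥ u = 0 := by
    have h1 : Tendsto (fun s : ℂ => (s - s₀) • (y - (s - s₀) • S₁.output s x₁)) (𝓝[≠] s₀)
        (𝓝 0) := by
      have := hsub.smul (tendsto_const_nhds (x := y) |>.sub hw)
      rwa [zero_smul] at this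
    have h2 := Matrix.tendsto_mulVec hres (tendsto_const_nhds (x := u))
    have h3 : (s₀⁻¹ • K) *ᵥ u = 0 := by
      refine tendsto_nhds_unique h2 (h1.congr' ?_)
      filter_upwards [hyG] with s hs
      rw [Matrix.smul_mulVec]
      nth_rewrite 1 [hs]
      rw [add_sub_cancel_right]
    rw [Matrix.smul_mulVec] at h3
    exact (smul_eq_zero.1 h3).resolve_left (inv_ne_zero hs₀')
  have hyR : y = R *ᵥ u + (s₀⁻¹ • K) *ᵥ w := by
    have h1 := (Matrix.tendsto_mulVec hR (tendsto_const_nhds (x := u))).add hw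
    refine tendsto_nhds_unique (tendsto_const_nhds.congr' ?_) h1
    filter_upwards [hyG] with s hs
    rw [Matrix.sub_mulVec, Matrix.smul_mulVec _ K, hKu, smul_zero, sub_zero]
    exact hs
  -- K is Hermitian, so its range is orthogonal to its kernel, which contains u.
  have hKw : star u ⬝ᵥ (K *ᵥ w) = 0 := by
    rw [Matrix.dotProduct_mulVec, ← hK.isHermitian.eq, ← Matrix.star_mulVec, hKu, star_zero,
      zero_dotProduct]
  have huy : (star u ⬝ᵥ y).im ≤ 0 := by
    rw [hyR, dotProduct_add, Matrix.smul_mulVec, dotProduct_smul, hKw, smul_zero, add_zero]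
    exact hRneg u
  -- As u = H(jω)y, strictness would give Im u*y > 0 for y ≠ 0.
  have hy0 : y = 0 := by
    by_contra hy0
    have h1 := hH.im_neg hω hy0
    rw [← hs₀, hu, im_star_dotProduct_comm] at h1
    linarith
  subst hy0
  rw [Matrix.mulVec_zero] at hu
  subst hu
  rw [Matrix.mulVec_zero, add_zero] at hx₁ hy
  exact hne (hS₁.eq_zero_of_eigenvector hx₁ hy) (S₂.state_eq_zero hd₂ hx₂)

/-- The closed loop has no eigenvalue at the origin. -/
theorem closedLoop_det_zero_ne_zero (hG : G.IsNegativeImaginary)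
    (hH : H.IsStrictlyNegativeImaginary) {S₁ : StateSpace n₁ m} {S₂ : StateSpace n₂ m}
    (hS₁ : S₁.IsMinimalRealization G) (hS₂ : S₂.IsMinimalRealization H)
    (hD : S₁.D * S₂.D = 0) (hdc : lambdaMax (G.dcGain * H.dcGain) < 1) :
    (Matrix.scalar _ 0 - (S₁.closedLoop (S₂.scaleOutput 1)).map (algebraMap ℝ ℂ)).det ≠ 0 := by
  intro h
  obtain ⟨u, hu, hloop⟩ := StateSpace.exists_loop_signal hS₁ hS₂ hD hG.not_isPole_zero
    (hH.not_isPole_of_re_nonneg 0 le_rfl) h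
  rw [TransferMatrix.eq_zero_of_lambdaMax_lt_one hdc ⟨zero_le_one, le_rfl⟩ hloop, norm_zero] at hu
  exact zero_ne_one hu

end Stability

theorem theorem1 {m n₁ n₂ : ℕ} (G H : TransferMatrix m)
    (hG : G.IsNegativeImaginary) (hH : H.IsStrictlyNegativeImaginary)
    (S₁ : StateSpace n₁ m) (S₂ : StateSpace n₂ m)
    (hS₁ : S₁.IsMinimalRealization G) (hS₂ : S₂.IsMinimalRealization H)
    (hinf : G.atInfinity * H.atInfinity = 0)
    (hHinf : H.atInfinity.PosSemidef)
    (hdc : lambdaMax (G.dcGain * H.dcGain) < 1) :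
    InternallyStable S₁ S₂ := by
  have hD : S₁.D * S₂.D = 0 := by
    rw [← hS₁.1, ← hS₂.1, StateSpace.atInfinity_transferMatrix,
      StateSpace.atInfinity_transferMatrix] at hinf
    exact hinf
  have hscale : S₂.scaleOutput 1 = S₂ := by simp [StateSpace.scaleOutput]
  refine ⟨by rw [hD, sub_zero]; exact isUnit_one, fun z hz => ?_⟩
  rw [Matrix.mem_spectrum_iff_isRoot_charpoly, Polynomial.IsRoot, Matrix.eval_charpoly] at hz
  by_contra! hre
  rcases hre.eq_or_lt with hre0 | hpos
  -- Eigenvalues on the negative imaginary axis are reflected to the positive one by conjugation.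
  · rcases lt_trichotomy z.im 0 with him | him | him
    · refine closedLoop_det_ne_zero_of_pos hG hH hS₁ hS₂ hD (neg_pos.2 him) ?_
      rw [show Complex.I * ((-z.im : ℝ) : ℂ) = star z by apply Complex.ext <;> simp [← hre0]]
      exact Matrix.det_scalar_conj_sub _ hz
    · refine closedLoop_det_zero_ne_zero hG hH hS₁ hS₂ hD hdc ?_
      rw [hscale]
      rwa [show z = 0 from Complex.ext hre0.symm him] at hz
    · refine closedLoop_det_ne_zero_of_pos hG hH hS₁ hS₂ hD him ?_
      rw [show Complex.I * (z.im : ℂ) = z by apply Complex.ext <;> simp [← hre0]]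
      exact hz
  · refine closedLoop_det_ne_zero_of_re_pos hG hH hS₁ hS₂ hD hdc hpos ?_
    rw [hscale]
    exact hz
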